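/- All graphs are finite, simple and nonempty. "Contains" refers to not necessarily induced subgraphs, while "$H$-free" means having no induced subgraph isomorphic to $H$. A graph $G$ is *$2$-connected* if it has at least three vertices, is connected and has no cut vertex. It is *distance-hereditary* if it contains none of the following as an induced subgraph: the house (vertices $a,b,c,d,e$, edges $ab,bc,cd,ad,ae,be$), a hole (a chordless cycle on at least $5$ vertices), the domino (vertices $a,b,c,d,e,h$, edges $ab,bc,cd,ad,be,eh,ch$), the gem (vertices $a,b,c,d,e$, edges $ab,bc,cd,ae,be,ce,de$). It is *m-decyclable* (matching-decyclable) if there is a partition $(M,F)$ of $E(G)$ such that $M$ is a matching and $F$ is acyclic. It is *sparse* if $|E(H)|\le\lfloor\frac32|V(H)|\rfloor-1$ for every (nonempty) subgraph $H$ of $G$. **Theorem.** Let $G$ be a $2$-connected distance-hereditary graph. Then the following are equivalent: (a) $G$ is m-decyclable; (b) $G$ is sparse and $K_{2,4}$-free; (c) $G$ is (isomorphic to) one of the following graphs: the triangle $K_3$, the square (the $4$-cycle $C_4$), the diamond ($C_4$ plus one chord), $K_{2,3}$, or $K_{3,3}^-$ (the graph $K_{3,3}$ with one edge removed). -/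

import Mathlib

namespace MDecyc

open SimpleGraph

/-- A finite graph is `2`-connected if it has at least three vertices, is connected, and has no
cut vertex (deleting any single vertex leaves a connected graph). -/
def TwoConnected {V : Type*} (G : SimpleGraph V) : Prop :=
  3 ≤ Nat.card V ∧ G.Connected ∧ ∀ v : V, (G.induce {v}ᶜ).Connected

/-- The house: vertices `a, b, c, d, e` numbered `0, 1, 2, 3, 4`,
edges `ab, bc, cd, ad, ae, be`. -/
def house : SimpleGraph (Fin 5) :=
  fromEdgeSet {s(0, 1), s(1, 2), s(2, 3), s(0, 3), s(0, 4), s(1, 4)}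

/-- The domino: vertices `a, b, c, d, e, h` numbered `0, 1, 2, 3, 4, 5`,
edges `ab, bc, cd, ad, be, eh, ch`. -/
def domino : SimpleGraph (Fin 6) :=
  fromEdgeSet {s(0, 1), s(1, 2), s(2, 3), s(0, 3), s(1, 4), s(4, 5), s(2, 5)}

/-- The gem: vertices `a, b, c, d, e` numbered `0, 1, 2, 3, 4`,
edges `ab, bc, cd, ae, be, ce, de`. -/
def gem : SimpleGraph (Fin 5) :=
  fromEdgeSet {s(0, 1), s(1, 2), s(2, 3), s(0, 4), s(1, 4), s(2, 4), s(3, 4)}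

/-- `G` is `H`-free: `G` does not contain `H` as an induced subgraph. -/
def IndFree {V W : Type*} (H : SimpleGraph W) (G : SimpleGraph V) : Prop :=
  ¬ H.IsIndContained G

/-- A distance-hereditary graph is a (house, hole, domino, gem)-free graph, where a hole is a
chordless cycle with at least five vertices. -/
def DistanceHereditary {V : Type*} (G : SimpleGraph V) : Prop :=
  IndFree house G ∧ (∀ k : ℕ, 5 ≤ k → IndFree (cycleGraph k) G) ∧ IndFree domino G ∧ IndFree gem G

/-- A partition `(M, F)` of the edge set of `G` such that `M` is a matching and `F` is acyclic.
(The vertices of the subgraph `M` are exactly the matched ones.) -/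
def MDecyclable {V : Type*} (G : SimpleGraph V) : Prop :=
  ∃ (M : G.Subgraph) (F : Set (Sym2 V)),
    M.IsMatching ∧ (fromEdgeSet F).IsAcyclic ∧ M.edgeSet ∪ F = G.edgeSet ∧ Disjoint M.edgeSet F

/-- A finite graph `H` is bad if `|E(H)| > ⌊(3/2) |V(H)|⌋ - 1`. The subtraction is in `ℤ`. -/
def Bad {V : Type*} (H : SimpleGraph V) : Prop :=
  (H.edgeSet.ncard : ℤ) > ⌊(3 / 2 : ℚ) * (Nat.card V : ℚ)⌋ - 1

/-- A graph is sparse if it contains no bad (not necessarily induced) subgraph. Graphs, and hence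
subgraphs, are nonempty. -/
def Sparse {V : Type*} (G : SimpleGraph V) : Prop :=
  ∀ H : G.Subgraph, H.verts.Nonempty → ¬ Bad H.coe

/-- The triangle `K₃`. -/
def triangle : SimpleGraph (Fin 3) := completeGraph (Fin 3)

/-- The square: a `4`-cycle without chords. -/
def square : SimpleGraph (Fin 4) := cycleGraph 4

/-- The diamond: a `4`-cycle plus one chord. -/
def diamond : SimpleGraph (Fin 4) := cycleGraph 4 ⊔ edge 0 2

/-- The complete bipartite graph `K_{m,n}`. -/
def K (m n : ℕ) : SimpleGraph (Fin m ⊕ Fin n) := completeBipartiteGraph (Fin m) (Fin n)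

/-- The graph `K_{3,3}` with one edge removed. -/
def K33Minus : SimpleGraph (Fin 3 ⊕ Fin 3) := (K 3 3).deleteEdges {s(Sum.inl 0, Sum.inr 0)}

end MDecyc

namespace MDecyc

open SimpleGraph

/-! (a) ⇒ (b): a matching plus a forest on `n` vertices has at most `n/2 + (n - 1)` edges, and such
decompositions pass to subgraphs, so `G` is sparse. `K 2 4` meets the sparsity bound with equality,
but its matchings have at most two edges, so it does not split either.

(b) ⇒ (c): grow an induced subgraph `H` by shortest ears. If `H` has short induced paths and lies
densely enough in short cycles, a shortest ear with two or more inner vertices creates a hole, a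
house or a domino (`IsShortestEar.length_eq_one`). So, unless `H` is all of `G`, some outer vertex
has two neighbours in `H`. Starting from an edge gives a triangle or a square. Sparsity allows at
most two neighbours at each extension, and house- and `K 2 4`-freeness fix where they lie: triangle
→ diamond, and square → `K 2 3` → `K33Minus`. The diamond and `K33Minus` have too many edges to be
extended.

(c) ⇒ (a): explicit decompositions of the five graphs. -/

/-- An ear of length `k + 1` on `S`: a walk `p 0, …, p (k + 1)` whose distinct ends lie in `S` and
whose `k ≥ 1` inner vertices lie outside `S`. -/
structure IsEar {V : Type*} (G : SimpleGraph V) (S : Set V) (k : ℕ) (p : ℕ → V) : Prop where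
  pos : 1 ≤ k
  start_mem : p 0 ∈ S
  end_mem : p (k + 1) ∈ S
  ends_ne : p 0 ≠ p (k + 1)
  inner_notMem : ∀ i, 1 ≤ i → i ≤ k → p i ∉ S
  adj : ∀ i ≤ k, G.Adj (p i) (p (i + 1))

/-- A shortest ear on `S`. -/
structure IsShortestEar {V : Type*} (G : SimpleGraph V) (S : Set V) (k : ℕ) (p : ℕ → V) : Prop
    extends IsEar G S k p where
  le : ∀ l q, IsEar G S l q → k ≤ l

/-! ### Shortest ears and their chords -/

section Ear

variable {V : Type*} {G : SimpleGraph V} {S : Set V} {k : ℕ} {p : ℕ → V}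

lemma exists_isEar (hG : G.Connected) (hcut : ∀ v, (G.induce {v}ᶜ).Connected)
    (hS : S.Nontrivial) (hne : S ≠ Set.univ) : ∃ k p, IsEar G S k p := by
  classical
  obtain ⟨x, hx⟩ := (Set.ne_univ_iff_exists_notMem S).1 hne
  obtain ⟨s₀, hs₀⟩ := hS.nonempty
  -- Leave `S` along an edge `d`, then return to `S` in `G` minus `d.fst`, which stays connected;
  -- hence the two ends differ.
  obtain ⟨w⟩ := hG.preconnected s₀ x
  obtain ⟨d, -, hs, hv⟩ := w.exists_boundary_dart S hs₀ hx
  obtain ⟨t, ht, hts⟩ := hS.exists_ne d.fst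
  have hvs : d.snd ≠ d.fst := d.adj.ne'
  obtain ⟨u⟩ := (hcut d.fst).preconnected ⟨d.snd, hvs⟩ ⟨t, hts⟩
  have hex : ∃ n, n ≤ u.length ∧ (u.getVert n : V) ∈ S :=
    ⟨u.length, le_rfl, by simpa using ht⟩
  obtain ⟨hn, hnS⟩ := Nat.find_spec hex
  have hmin : ∀ i < Nat.find hex, (u.getVert i : V) ∉ S := fun i hi h =>
    Nat.find_min hex hi ⟨by omega, h⟩
  have hpos : 1 ≤ Nat.find hex := by
    by_contra h0
    rw [show Nat.find hex = 0 by omega] at hnS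
    exact hv (by simpa using hnS)
  -- The edge `d` precedes the walk `u`, cut at its first vertex in `S`; hence the index shift by
  -- one.
  refine ⟨Nat.find hex, fun i => if i = 0 then d.fst else u.getVert (i - 1), ?_⟩
  refine ⟨hpos, by simpa using hs, by simpa using hnS, ?_, ?_, ?_⟩
  · simpa [-SetLike.coe_mem] using fun h => (u.getVert (Nat.find hex)).2 h.symm
  · intro i h1 h2
    simpa [show i ≠ 0 by omega] using hmin (i - 1) (by omega)
  · intro i hi
    rcases Nat.eq_zero_or_pos i with rfl | h0
    · simp
    · have := u.adj_getVert_succ (i := i - 1) (by omega)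
      rw [show i - 1 + 1 = i by omega] at this
      simpa [show i ≠ 0 by omega] using this

lemma exists_isShortestEar (hG : G.Connected) (hcut : ∀ v, (G.induce {v}ᶜ).Connected)
    (hS : S.Nontrivial) (hne : S ≠ Set.univ) : ∃ k p, IsShortestEar G S k p := by
  classical
  have hex := exists_isEar hG hcut hS hne
  obtain ⟨p, hp⟩ := Nat.find_spec hex
  exact ⟨_, p, hp, fun l q hq => Nat.find_min' hex ⟨q, hq⟩⟩

/-- Otherwise leaving the ear at `p i` towards `x` gives an ear with only `i < k` inner vertices. -/
lemma IsShortestEar.eq_start (h : IsShortestEar G S k p) {i : ℕ} {x : V} (hi : 1 ≤ i) (hik : i < k)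
    (hx : x ∈ S) (hadj : G.Adj (p i) x) : x = p 0 := by
  by_contra hne
  have hear : IsEar G S i (fun m => if m ≤ i then p m else x) := by
    refine ⟨hi, by simpa using h.start_mem, by simpa using hx, by simpa using Ne.symm hne, ?_, ?_⟩
    · intro m h1 h2
      simpa [h2] using h.inner_notMem m h1 (by omega)
    · intro m hm
      rcases hm.lt_or_eq with hlt | rfl
      · simpa [hm, Nat.succ_le_of_lt hlt] using h.adj m (by omega)
      · simpa using hadj
  have := h.le _ _ hear
  omega

lemma IsShortestEar.eq_end (h : IsShortestEar G S k p) {i : ℕ} {x : V} (hi : 1 < i) (hik : i ≤ k)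
    (hx : x ∈ S) (hadj : G.Adj (p i) x) : x = p (k + 1) := by
  by_contra hne
  have hear : IsEar G S (k + 1 - i) (fun m => if m = 0 then x else p (m + i - 1)) := by
    refine ⟨by omega, by simpa using hx, ?_, ?_, ?_, ?_⟩
    · simpa [show k + 1 - i + 1 + i - 1 = k + 1 by omega] using h.end_mem
    · simpa [show k + 1 - i + 1 + i - 1 = k + 1 by omega] using hne
    · intro m h1 h2
      simpa [show m ≠ 0 by omega] using h.inner_notMem (m + i - 1) (by omega) (by omega)
    · intro m hm
      rcases Nat.eq_zero_or_pos m with rfl | h0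
      · simpa using hadj.symm
      · have := h.adj (m + i - 1) (by omega)
        rw [show m + i - 1 + 1 = m + 1 + i - 1 by omega] at this
        simpa [show m ≠ 0 by omega] using this
  have := h.le _ _ hear
  omega

/-- A chord would be a shortcut skipping `j - i - 1 ≥ 1` inner vertices. -/
lemma IsShortestEar.inner_not_adj (h : IsShortestEar G S k p) {i j : ℕ} (hi : 1 ≤ i)
    (hij : i + 1 < j) (hj : j ≤ k) : ¬ G.Adj (p i) (p j) := by
  intro hadj
  have hear : IsEar G S (k - (j - i - 1)) (fun m => if m ≤ i then p m else p (m + (j - i - 1))) := by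
    refine ⟨by omega, by simpa using h.start_mem, ?_, ?_, ?_, ?_⟩
    · simpa [show ¬ k - (j - i - 1) + 1 ≤ i by omega,
        show k - (j - i - 1) + 1 + (j - i - 1) = k + 1 by omega] using h.end_mem
    · simpa [show ¬ k - (j - i - 1) + 1 ≤ i by omega,
        show k - (j - i - 1) + 1 + (j - i - 1) = k + 1 by omega] using h.ends_ne
    · intro m h1 h2
      by_cases hm : m ≤ i
      · simpa [hm] using h.inner_notMem m h1 (by omega)
      · simpa [hm] using h.inner_notMem (m + (j - i - 1)) (by omega) (by omega)
    · intro m hm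
      rcases lt_trichotomy m i with hlt | rfl | hgt
      · simpa [hlt.le, Nat.succ_le_of_lt hlt] using h.adj m (by omega)
      · simpa [show m + 1 + (j - m - 1) = j by omega] using hadj
      · have := h.adj (m + (j - i - 1)) (by omega)
        rw [show m + (j - i - 1) + 1 = m + 1 + (j - i - 1) by omega] at this
        simpa [show ¬ m ≤ i by omega, show ¬ m + 1 ≤ i by omega] using this
  have := h.le _ _ hear
  omega

lemma IsShortestEar.adj_mem_iff (h : IsShortestEar G S k p) (hk : 2 ≤ k) {i : ℕ} {x : V}
    (hi : 1 ≤ i) (hik : i ≤ k) (hx : x ∈ S) :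
    G.Adj (p i) x ↔ i = 1 ∧ x = p 0 ∨ i = k ∧ x = p (k + 1) := by
  constructor
  · intro hadj
    rcases hik.lt_or_eq with hlt | heq
    · have h0 := h.eq_start hi hlt hx hadj
      rcases hi.lt_or_eq with h1 | h1
      · exact absurd (h0.symm.trans (h.eq_end h1 hik hx hadj)) h.ends_ne
      · exact Or.inl ⟨h1.symm, h0⟩
    · exact Or.inr ⟨heq, h.eq_end (by omega) hik hx hadj⟩
  · rintro (⟨rfl, rfl⟩ | ⟨rfl, rfl⟩)
    · exact (h.adj 0 (by omega)).symm
    · exact h.adj _ le_rfl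

/-- Ears are only walks, so distinctness also comes from minimality: a repeated vertex would inherit
the edge to `p (j + 1)`, which is a shortcut. -/
lemma IsShortestEar.inner_ne (h : IsShortestEar G S k p) (hk : 2 ≤ k) {i j : ℕ} (hi : 1 ≤ i)
    (hij : i < j) (hj : j ≤ k) : p i ≠ p j := by
  intro heq
  have hadj : G.Adj (p i) (p (j + 1)) := heq ▸ h.adj j hj
  rcases hj.lt_or_eq with hlt | rfl
  · exact h.inner_not_adj hi (by omega) (by omega) hadj
  · exact h.ends_ne (h.eq_start hi hij h.end_mem hadj).symm

lemma IsShortestEar.ne (h : IsShortestEar G S k p) (hk : 2 ≤ k) {i j : ℕ} (hij : i < j)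
    (hj : j ≤ k + 1) : p i ≠ p j := by
  rcases Nat.eq_zero_or_pos i with rfl | h0
  · rcases hj.lt_or_eq with hlt | rfl
    · exact fun heq => h.inner_notMem j (by omega) (by omega) (heq ▸ h.start_mem)
    · exact h.ends_ne
  · rcases hj.lt_or_eq with hlt | rfl
    · exact h.inner_ne hk h0 hij (by omega)
    · exact fun heq => h.inner_notMem i (by omega) (by omega) (heq ▸ h.end_mem)

/-- A shortest ear with at least two inner vertices has no chords besides its closing edge. -/
lemma IsShortestEar.adj_iff (h : IsShortestEar G S k p) (hk : 2 ≤ k) {i j : ℕ} (hij : i < j)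
    (hj : j ≤ k + 1) (hne : ¬ (i = 0 ∧ j = k + 1)) : G.Adj (p i) (p j) ↔ j = i + 1 := by
  refine ⟨fun hadj => ?_, ?_⟩
  · rcases Nat.eq_zero_or_pos i with rfl | h0
    · rcases (h.adj_mem_iff hk (by omega) (by omega) h.start_mem).1 hadj.symm with h1 | h1
      · exact h1.1
      · exact absurd h1.2 h.ends_ne
    · rcases hj.lt_or_eq with hlt | rfl
      · by_contra hne'
        exact h.inner_not_adj h0 (by omega) (by omega) hadj
      · rcases (h.adj_mem_iff hk h0 (by omega) h.end_mem).1 hadj with h1 | h1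
        · exact absurd h1.2.symm h.ends_ne
        · omega
  · rintro rfl
    exact h.adj i (by omega)

end Ear

/-! ### Recognising holes, houses and dominoes -/

section Hole

variable {V : Type*} {G : SimpleGraph V}

lemma isIndContained_of_lt {W : Type*} [LinearOrder W] {H : SimpleGraph W} (f : W → V)
    (hf : ∀ i j, i < j → f i ≠ f j ∧ (G.Adj (f i) (f j) ↔ H.Adj i j)) : H.IsIndContained G := by
  refine ⟨⟨⟨f, fun i j hij => ?_⟩, ?_⟩⟩
  · rcases lt_trichotomy i j with h | h | h
    · exact absurd hij (hf i j h).1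
    · exact h
    · exact absurd hij.symm (hf j i h).1
  · intro i j
    change G.Adj (f i) (f j) ↔ _
    rcases lt_trichotomy i j with h | rfl | h
    · exact (hf i j h).2
    · simp
    · rw [G.adj_comm, H.adj_comm, (hf j i h).2]

lemma cycleGraph_isIndContained {n : ℕ} {f : ℕ → V}
    (hf : ∀ i j, i < j → j < n →
      f i ≠ f j ∧ (G.Adj (f i) (f j) ↔ j = i + 1 ∨ i = 0 ∧ j + 1 = n)) :
    (cycleGraph n).IsIndContained G := by
  refine isIndContained_of_lt (fun i => f i) fun i j hij => ?_
  refine ⟨(hf _ _ hij j.2).1, ?_⟩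
  have hj := j.2
  -- In `Fin n` the difference `i - j` wraps around to `n + i - j`, which is `1` exactly at the
  -- closing edge.
  rw [cycleGraph_adj', (hf _ _ hij j.2).2, Fin.coe_sub_iff_lt.2 hij, Fin.coe_sub_iff_le.2 hij.le]
  omega

lemma house_isIndContained {a b c d e : V} (hab : G.Adj a b) (hbc : G.Adj b c) (hcd : G.Adj c d)
    (had : G.Adj a d) (hae : G.Adj a e) (hbe : G.Adj b e) (hac : ¬ G.Adj a c) (hbd : ¬ G.Adj b d)
    (hce : ¬ G.Adj c e) (hde : ¬ G.Adj d e) : house.IsIndContained G := by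
  -- Nonadjacent vertices are distinct because a third vertex is adjacent to only one of them.
  have h1 : a ≠ c := by rintro rfl; exact hce hae
  have h2 : b ≠ d := by rintro rfl; exact hde hbe
  have h3 : c ≠ e := by rintro rfl; exact hac hae
  have h4 : d ≠ e := by rintro rfl; exact hbd hbe
  refine isIndContained_of_lt ![a, b, c, d, e] fun i j hij => ?_
  fin_cases i <;> fin_cases j <;> first | exact absurd hij (by decide) | skip
  all_goals simp [house, hab, hbc, hcd, had, hae, hbe, hac, hbd, hce, hde, hab.ne, hbc.ne, hcd.ne,
    had.ne, hae.ne, hbe.ne, h1, h2, h3, h4]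

lemma domino_isIndContained {a b c d e f : V} (hab : G.Adj a b) (hbc : G.Adj b c)
    (hcd : G.Adj c d) (had : G.Adj a d) (hbe : G.Adj b e) (hef : G.Adj e f) (hcf : G.Adj c f)
    (hac : ¬ G.Adj a c) (hbd : ¬ G.Adj b d) (hae : ¬ G.Adj a e) (haf : ¬ G.Adj a f)
    (hde : ¬ G.Adj d e) (hdf : ¬ G.Adj d f) (hbf : ¬ G.Adj b f) (hce : ¬ G.Adj c e) :
    domino.IsIndContained G := by
  have h1 : a ≠ c := by rintro rfl; exact haf hcf
  have h2 : b ≠ d := by rintro rfl; exact hde hbe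
  have h3 : a ≠ e := by rintro rfl; exact haf hef
  have h4 : a ≠ f := by rintro rfl; exact hac hcf.symm
  have h5 : d ≠ e := by rintro rfl; exact hdf hef
  have h6 : d ≠ f := by rintro rfl; exact hde hef.symm
  have h7 : b ≠ f := by rintro rfl; exact haf hab
  have h8 : c ≠ e := by rintro rfl; exact hde hcd.symm
  refine isIndContained_of_lt ![a, b, c, d, e, f] fun i j hij => ?_
  fin_cases i <;> fin_cases j <;> first | exact absurd hij (by decide) | skip
  all_goals simp [domino, hab, hbc, hcd, had, hbe, hef, hcf, hac, hbd, hae, haf, hde, hdf, hbf,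
    hce, hab.ne, hbc.ne, hcd.ne, had.ne, hbe.ne, hef.ne, hcf.ne, h1, h2, h3, h4, h5, h6, h7, h8]

end Hole

/-! ### Shortest ears in distance-hereditary graphs -/

/-- Any two vertices are joined by an induced path of length at most three. -/
def HasShortPaths {W : Type*} (H : SimpleGraph W) : Prop :=
  ∀ s t, s ≠ t → H.Adj s t ∨ (∃ c, H.Adj s c ∧ H.Adj c t) ∨
    ∃ c d, H.Adj s c ∧ H.Adj c d ∧ H.Adj d t ∧ ¬ H.Adj s d ∧ ¬ H.Adj c t

/-- Every edge lies in a triangle or in a chordless `4`-cycle. -/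
def HasShortCycles {W : Type*} (H : SimpleGraph W) : Prop :=
  ∀ s t, H.Adj s t → (∃ c, H.Adj s c ∧ H.Adj t c) ∨
    ∃ c d, H.Adj t c ∧ H.Adj c d ∧ H.Adj d s ∧ ¬ H.Adj t d ∧ ¬ H.Adj s c ∧ c ≠ s ∧ d ≠ t

section Extension

variable {V W : Type*} {G : SimpleGraph V} {H : SimpleGraph W} {k : ℕ} {p : ℕ → V}

/-- The ear and its closing edge form a chordless cycle on `k + 2` vertices. -/
lemma exists_cycle_of_isShortestEar {S : Set V} (hole : ∀ k, 5 ≤ k → IndFree (cycleGraph k) G)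
    (hear : IsShortestEar G S k p) (hk : 2 ≤ k) (hadj : G.Adj (p 0) (p (k + 1))) : k = 2 := by
  by_contra hne
  refine hole (k + 2) (by omega) (cycleGraph_isIndContained (f := p) ?_)
  intro i j hij hj
  refine ⟨hear.ne hk hij (by omega), ?_⟩
  by_cases h : i = 0 ∧ j = k + 1
  · obtain ⟨rfl, rfl⟩ := h
    simp [hadj]
  · rw [hear.adj_iff hk hij (by omega) h]
    omega

/-- For nonadjacent ends, an induced path of two or three edges in `H` closes the ear to a cycle on
`k + 3` or `k + 4` vertices. Inner ear vertices meet `H` only at the ends, so this is a hole. -/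
lemma ends_adj_of_isShortestEar (hole : ∀ k, 5 ≤ k → IndFree (cycleGraph k) G) (φ : H ↪g G)
    (hP : HasShortPaths H) (hear : IsShortestEar G (Set.range φ) k p) (hk : 2 ≤ k) :
    G.Adj (p 0) (p (k + 1)) := by
  by_contra hst
  obtain ⟨s, hs⟩ := hear.start_mem
  obtain ⟨t, ht⟩ := hear.end_mem
  have hst' : s ≠ t := by rintro rfl; exact hear.ends_ne (hs.symm.trans ht)
  have hmem : ∀ {i} (w : W), 1 ≤ i → i ≤ k → p i ≠ φ w := fun w h1 h2 h =>
    hear.inner_notMem _ h1 h2 (h ▸ ⟨w, rfl⟩)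
  rw [← hs, ← ht, φ.map_adj_iff] at hst
  have key : ∀ {i} (w : W), 1 ≤ i → i ≤ k → w ≠ s → w ≠ t → ¬ G.Adj (p i) (φ w) := by
    intro i w h1 h2 hws hwt hadj
    rcases (hear.adj_mem_iff hk h1 h2 ⟨w, rfl⟩).1 hadj with h | h
    · exact hws (φ.injective (h.2.trans hs.symm))
    · exact hwt (φ.injective (h.2.trans ht.symm))
  rcases hP s t hst' with h | ⟨c, hsc, hct⟩ | ⟨c, d, hsc, hcd, hdt, hsd, hct⟩
  · exact hst h
  · refine hole (k + 3) (by omega) (cycleGraph_isIndContained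
      (f := fun i => if i = k + 2 then φ c else p i) ?_)
    intro i j hij hj
    have hi : i ≠ k + 2 := by omega
    by_cases hj2 : j = k + 2
    · subst hj2
      simp only [hi, if_false, if_true]
      rcases Nat.eq_zero_or_pos i with rfl | h0
      · rw [← hs]
        simp [φ.injective.eq_iff, φ.map_adj_iff, hsc, hsc.ne]
      · by_cases hik : i = k + 1
        · subst hik
          rw [← ht]
          simp [φ.injective.eq_iff, φ.map_adj_iff, hct.symm, hct.ne']
        · refine ⟨hmem c h0 (by omega), ?_⟩
          have := key c h0 (by omega) hsc.ne' hct.ne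
          simp only [this, false_iff]
          omega
    · simp only [hi, hj2, if_false]
      refine ⟨hear.ne hk hij (by omega), ?_⟩
      by_cases h : i = 0 ∧ j = k + 1
      · obtain ⟨rfl, rfl⟩ := h
        rw [← hs, ← ht, φ.map_adj_iff]
        simp only [hst, false_iff]
        omega
      · rw [hear.adj_iff hk hij (by omega) h]
        omega
  · have hcs := hsc.ne'
    have hct' : c ≠ t := by rintro rfl; exact hst hsc
    have hds : d ≠ s := by rintro rfl; exact hst hdt
    have hdt' := hdt.ne
    refine hole (k + 4) (by omega) (cycleGraph_isIndContained
      (f := fun i => if i = k + 3 then φ c else if i = k + 2 then φ d else p i) ?_)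
    intro i j hij hj
    have hi : i ≠ k + 3 := by omega
    by_cases hj3 : j = k + 3
    · subst hj3
      simp only [hi, if_false, if_true]
      by_cases hi2 : i = k + 2
      · simp [hi2, φ.injective.eq_iff, φ.map_adj_iff, hcd.symm, hcd.ne']
      simp only [hi2, if_false]
      rcases Nat.eq_zero_or_pos i with rfl | h0
      · rw [← hs]
        simp [φ.injective.eq_iff, φ.map_adj_iff, hsc, hsc.ne]
      · by_cases hik : i = k + 1
        · subst hik
          rw [← ht]
          simp [φ.injective.eq_iff, φ.map_adj_iff, H.adj_comm t c, hct, hct'.symm]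
        · refine ⟨hmem c h0 (by omega), ?_⟩
          have := key c h0 (by omega) hcs hct'
          simp only [this, false_iff]
          omega
    by_cases hj2 : j = k + 2
    · subst hj2
      have hi2 : i ≠ k + 2 := by omega
      simp only [hi, hi2, hj3, if_false, if_true]
      rcases Nat.eq_zero_or_pos i with rfl | h0
      · rw [← hs]
        simp [φ.injective.eq_iff, φ.map_adj_iff, hsd, hds.symm]
      · by_cases hik : i = k + 1
        · subst hik
          rw [← ht]
          simp [φ.injective.eq_iff, φ.map_adj_iff, hdt.symm, hdt.ne']
        · refine ⟨hmem d h0 (by omega), ?_⟩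
          have := key d h0 (by omega) hds hdt'
          simp only [this, false_iff]
          omega
    · have hi2 : i ≠ k + 2 := by omega
      simp only [hi, hj2, hj3, hi2, if_false]
      refine ⟨hear.ne hk hij (by omega), ?_⟩
      by_cases h : i = 0 ∧ j = k + 1
      · obtain ⟨rfl, rfl⟩ := h
        rw [← hs, ← ht, φ.map_adj_iff]
        simp only [hst, false_iff]
        omega
      · rw [hear.adj_iff hk hij (by omega) h]
        omega

/-- A longer ear would close to a chordless `4`-cycle on an edge of `H`. Glued along that edge to a
triangle of `H` it is a house, and to a chordless `4`-cycle of `H` a domino. -/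
lemma IsShortestEar.length_eq_one (hdh : DistanceHereditary G) (φ : H ↪g G)
    (hP : HasShortPaths H) (hC : HasShortCycles H)
    (hear : IsShortestEar G (Set.range φ) k p) : k = 1 := by
  obtain ⟨hhouse, hhole, hdomino, -⟩ := hdh
  by_contra hne
  have hk : 2 ≤ k := by have := hear.pos; omega
  have hst := ends_adj_of_isShortestEar hhole φ hP hear hk
  obtain rfl := exists_cycle_of_isShortestEar hhole hear hk hst
  obtain ⟨s, hs⟩ := hear.start_mem
  obtain ⟨t, ht⟩ := hear.end_mem
  have h01 := hear.adj 0 (by omega)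
  have h12 := hear.adj 1 (by omega)
  have h23 := hear.adj 2 (by omega)
  have h02 : ¬ G.Adj (p 0) (p 2) := by rw [hear.adj_iff hk] <;> omega
  have h13 : ¬ G.Adj (p 1) (p 3) := by rw [hear.adj_iff hk] <;> omega
  simp only [zero_add, Nat.reduceAdd] at hst h01 h12 h23 ht
  have key1 : ∀ w, w ≠ s → ¬ G.Adj (p 1) (φ w) := by
    intro w hw hadj
    rcases (hear.adj_mem_iff hk le_rfl (by omega) ⟨w, rfl⟩).1 hadj with h | h
    · exact hw (φ.injective (h.2.trans hs.symm))
    · omega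
  have key2 : ∀ w, w ≠ t → ¬ G.Adj (p 2) (φ w) := by
    intro w hw hadj
    rcases (hear.adj_mem_iff hk (by omega) le_rfl ⟨w, rfl⟩).1 hadj with h | h
    · omega
    · exact hw (φ.injective (h.2.trans ht.symm))
  rw [← hs] at hst h01 h02
  rw [← ht] at hst h13 h23
  rcases hC s t (φ.map_adj_iff.1 hst) with ⟨c, hsc, htc⟩ | ⟨c, d, htc, hcd, hds, htd, hsc, hcs, hdt⟩
  · exact hhouse (house_isIndContained hst h23.symm h12.symm h01 (φ.map_adj_iff.2 hsc)
      (φ.map_adj_iff.2 htc) h02 (fun h => h13 h.symm) (key2 c htc.ne') (key1 c hsc.ne'))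
  · exact hdomino (domino_isIndContained h01.symm hst h23.symm h12
      (φ.map_adj_iff.2 hds.symm) (φ.map_adj_iff.2 hcd.symm) (φ.map_adj_iff.2 htc)
      h13 h02 (key1 d hds.ne) (key1 c hcs) (key2 d hdt) (key2 c htc.ne')
      (fun h => hsc (φ.map_adj_iff.1 h)) (fun h => htd (φ.map_adj_iff.1 h)))

/-- A proper induced subgraph with short paths and short cycles in a `2`-connected
distance-hereditary graph has two vertices with a common outer neighbour. -/
lemma exists_outer_common_neighbor (h2 : TwoConnected G) (hdh : DistanceHereditary G) [Nontrivial W]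
    (φ : H ↪g G) (hP : HasShortPaths H) (hC : HasShortCycles H) (hφ : ¬ Function.Surjective φ) :
    ∃ v ∉ Set.range φ, ∃ i j, i ≠ j ∧ G.Adj v (φ i) ∧ G.Adj v (φ j) := by
  have hS : (Set.range φ).Nontrivial := by
    obtain ⟨x, y, hxy⟩ := exists_pair_ne W
    exact ⟨_, ⟨x, rfl⟩, _, ⟨y, rfl⟩, φ.injective.ne hxy⟩
  obtain ⟨k, p, hear⟩ := exists_isShortestEar h2.2.1 h2.2.2 hS
    (fun h => hφ (Set.range_eq_univ.1 h))
  obtain rfl := hear.length_eq_one hdh φ hP hC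
  obtain ⟨s, hs⟩ := hear.start_mem
  obtain ⟨t, ht⟩ := hear.end_mem
  refine ⟨p 1, hear.inner_notMem 1 le_rfl le_rfl, s, t, ?_, ?_, ?_⟩
  · rintro rfl
    exact hear.ends_ne (hs.symm.trans ht)
  · rw [hs]; exact (hear.adj 0 (by omega)).symm
  · rw [ht]; exact hear.adj 1 le_rfl

end Extension

/-! ### Matching plus forest: necessary conditions -/

/-- `H` is the union of a graph of maximum degree at most one and an acyclic graph. -/
def Splits {W : Type*} (H : SimpleGraph W) : Prop :=
  ∃ M F : SimpleGraph W, M ⊔ F = H ∧ (∀ u v w, M.Adj u v → M.Adj u w → v = w) ∧ F.IsAcyclic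

section Splits

variable {V W : Type*} {G : SimpleGraph V} {H : SimpleGraph W}

/-- `Splits` lets the two parts overlap; removing the matching edges from the forest restores
disjointness. -/
lemma mDecyclable_iff_splits : MDecyclable G ↔ Splits G := by
  constructor
  · rintro ⟨M, F, hM, hF, hMF, -⟩
    refine ⟨M.spanningCoe, fromEdgeSet F, ?_, fun u v w => hM.eq_of_adj_left, hF⟩
    ext u v
    have h : s(u, v) ∈ M.edgeSet ∪ F ↔ s(u, v) ∈ G.edgeSet := by rw [hMF]
    simp only [Set.mem_union, Subgraph.mem_edgeSet, mem_edgeSet] at h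
    simp only [sup_adj, Subgraph.spanningCoe_adj, fromEdgeSet_adj]
    constructor
    · rintro (h1 | h1)
      · exact M.adj_sub h1
      · exact h.1 (Or.inr h1.1)
    · exact fun h1 => (h.2 h1).imp id fun h2 => ⟨h2, h1.ne⟩
  · rintro ⟨M, F, rfl, hM, hF⟩
    refine ⟨⟨M.support, M.Adj, fun h => Or.inl h, fun h => ⟨_, h⟩, M.symm⟩,
      F.edgeSet \ M.edgeSet, ?_, ?_, ?_, ?_⟩
    · rintro v ⟨w, hw⟩
      exact ⟨w, hw, fun y hy => hM _ _ _ hy hw⟩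
    · refine hF.anti fun u v h => ?_
      rw [fromEdgeSet_adj] at h
      exact h.1.1
    · change M.edgeSet ∪ F.edgeSet \ M.edgeSet = (M ⊔ F).edgeSet
      rw [Set.union_sdiff_self, edgeSet_sup]
    · exact Set.disjoint_sdiff_right

lemma Splits.of_isContained (h : H.IsContained G) (hG : Splits G) : Splits H := by
  obtain ⟨f⟩ := h
  obtain ⟨M, F, rfl, hM, hF⟩ := hG
  refine ⟨M.comap f ⊓ H, F.comap f ⊓ H, ?_, ?_, ?_⟩
  · ext u v
    simp only [sup_adj, inf_adj, comap_adj, ← or_and_right, and_iff_right_iff_imp]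
    exact fun huv => f.toHom.map_adj huv
  · exact fun u v w h1 h2 => f.injective (hM _ _ _ h1.1 h2.1)
  · exact IsAcyclic.anti inf_le_left (hF.of_comap ⟨f, f.injective⟩)

/-- A forest extends to a spanning tree of the complete graph. -/
lemma ncard_edgeSet_lt_of_isAcyclic [Finite W] [Nonempty W] (h : H.IsAcyclic) :
    H.edgeSet.ncard + 1 ≤ Nat.card W := by
  obtain ⟨T, hHT, -, hT⟩ :=
    (connected_top (V := W)).exists_isTree_le_of_le_of_isAcyclic le_top h
  rw [← (isTree_iff_connected_and_card.1 hT).2, ← Nat.card_coe_set_eq]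
  exact Nat.succ_le_succ (Nat.card_mono (Set.toFinite _) (edgeSet_subset_edgeSet.2 hHT))

lemma two_mul_ncard_edgeSet_le [Finite W] (h : ∀ u v w, H.Adj u v → H.Adj u w → v = w) :
    2 * H.edgeSet.ncard ≤ Nat.card W := by
  classical
  have := Fintype.ofFinite W
  rw [← coe_edgeFinset, Set.ncard_coe_finset, ← sum_degrees_eq_twice_card_edges,
    Nat.card_eq_fintype_card]
  refine (Finset.sum_le_card_nsmul _ _ 1 fun u _ => ?_).trans (by simp)
  rw [← card_neighborFinset_eq_degree, Finset.card_le_one]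
  intro v hv w hw
  exact h u v w (by simpa using hv) (by simpa using hw)

lemma Splits.not_bad [Finite W] [Nonempty W] (h : Splits H) : ¬ Bad H := by
  obtain ⟨M, F, rfl, hM, hF⟩ := h
  have h1 := two_mul_ncard_edgeSet_le hM
  have h2 := ncard_edgeSet_lt_of_isAcyclic hF
  have h3 : (M ⊔ F).edgeSet.ncard ≤ M.edgeSet.ncard + F.edgeSet.ncard := by
    rw [edgeSet_sup]
    exact Set.ncard_union_le _ _
  have h4 : 2 * (M ⊔ F).edgeSet.ncard + 2 ≤ 3 * Nat.card W := by omega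
  rw [Bad, not_lt, Int.le_sub_one_iff, ← Int.add_one_le_iff, Int.le_floor]
  have h5 : (2 : ℚ) * (M ⊔ F).edgeSet.ncard + 2 ≤ 3 * Nat.card W := by exact_mod_cast h4
  push_cast
  linarith

lemma Splits.sparse [Finite V] (h : Splits G) : Sparse G := by
  intro H hH
  have : Nonempty H.verts := hH.to_subtype
  exact (h.of_isContained ⟨⟨H.hom, H.hom_injective⟩⟩).not_bad

/-- Every edge meets the side of size two, so the matching has at most two edges and the forest at
most five, against eight in total. -/
lemma not_splits_K_two_four : ¬ Splits (K 2 4) := by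
  rintro ⟨M, F, hMF, hM, hF⟩
  have h1 := ncard_edgeSet_lt_of_isAcyclic hF
  have hle : M ≤ K 2 4 := hMF ▸ le_sup_left
  have h3 : (K 2 4).edgeSet.ncard ≤ M.edgeSet.ncard + F.edgeSet.ncard := by
    rw [← hMF, edgeSet_sup]
    exact Set.ncard_union_le _ _
  have h4 : (K 2 4).edgeSet.ncard = 8 := by
    have := encard_edgeSet_completeBipartiteGraph (W₁ := Fin 2) (W₂ := Fin 4)
    rw [Set.ncard, K, this]
    simp
  have hinc : ∀ u, (M.incidenceSet u).ncard ≤ 1 := by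
    intro u
    rw [Set.ncard_le_one]
    rintro e ⟨he, hue⟩ e' ⟨he', hue'⟩
    obtain ⟨v, rfl⟩ := hue
    obtain ⟨w, rfl⟩ := hue'
    rw [hM u v w he he']
  have hsub : M.edgeSet ⊆ M.incidenceSet (Sum.inl 0) ∪ M.incidenceSet (Sum.inl 1) := by
    intro e he
    have hcase : Sum.inl 0 ∈ e ∨ Sum.inl 1 ∈ e := by
      have he' := edgeSet_subset_edgeSet.2 hle he
      induction e with
      | _ u v =>
        rcases u with u | u <;> rcases v with v | v <;>
          simp [K] at he' ⊢ <;> omega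
    exact hcase.imp (fun h => ⟨he, h⟩) fun h => ⟨he, h⟩
  have h5 := (Set.ncard_le_ncard hsub).trans (Set.ncard_union_le _ _)
  have h6 := hinc (Sum.inl 0)
  have h7 := hinc (Sum.inl 1)
  simp at h1
  omega

end Splits
-- Sparsity and one-vertex extensions
section Sparse

variable {V W : Type*} {G : SimpleGraph V} {H : SimpleGraph W}

lemma Sparse.two_mul_ncard_edgeSet_le [Finite W] [Nonempty W] (hG : Sparse G) (h : H.IsContained G) :
    2 * H.edgeSet.ncard + 2 ≤ 3 * Nat.card W := by
  obtain ⟨f⟩ := h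
  let e := f.isoToSubgraph
  have hne : f.toSubgraph.verts.Nonempty := ⟨f (Classical.arbitrary W), by simp⟩
  have h1 := hG f.toSubgraph hne
  have h2 : f.toSubgraph.coe.edgeSet.ncard = H.edgeSet.ncard := by
    rw [← Nat.card_coe_set_eq, ← Nat.card_coe_set_eq]
    exact (Nat.card_congr e.mapEdgeSet).symm
  rw [Bad, h2, ← Nat.card_congr e.toEquiv, not_lt, Int.le_sub_one_iff, ← Int.add_one_le_iff,
    Int.le_floor] at h1
  push_cast at h1
  have h3 : (2 : ℚ) * H.edgeSet.ncard + 2 ≤ 3 * Nat.card W := by linarith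
  exact_mod_cast h3

/-- The graph obtained from `H` by adding a vertex with neighbourhood `N`. -/
def addVertex (H : SimpleGraph W) (N : Finset W) : SimpleGraph (Option W) where
  Adj x y := match x, y with
    | some a, some b => H.Adj a b
    | some a, none => a ∈ N
    | none, some b => b ∈ N
    | none, none => False
  symm := ⟨by
    rintro (_ | a) (_ | b) h
    exacts [h, h, h, h.symm]⟩
  loopless := ⟨by
    rintro (_ | a) h
    exacts [h, H.loopless.irrefl a h]⟩

lemma ncard_edgeSet_addVertex [Finite W] (N : Finset W) :
    H.edgeSet.ncard + N.card ≤ (addVertex H N).edgeSet.ncard := by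
  have h1 : (Sym2.map some '' H.edgeSet).ncard = H.edgeSet.ncard :=
    Set.ncard_image_of_injective _ (Sym2.map.injective (Option.some_injective W))
  have h2 : ((fun a => s(none, some a)) '' (N : Set W)).ncard = N.card := by
    rw [Set.ncard_image_of_injective, Set.ncard_coe_finset]
    intro a b hab
    simpa using hab
  have hdisj : Disjoint (Sym2.map some '' H.edgeSet)
      ((fun a => s(none, some a)) '' (N : Set W)) := by
    rw [Set.disjoint_left]
    rintro _ ⟨e, -, rfl⟩ ⟨a, -, h⟩
    have : (none : Option W) ∈ Sym2.map some e := h ▸ Sym2.mem_mk_left _ _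
    simp at this
  rw [← h1, ← h2, ← Set.ncard_union_eq hdisj]
  refine Set.ncard_le_ncard ?_
  rintro _ (⟨e, he, rfl⟩ | ⟨a, ha, rfl⟩)
  · induction e with
    | _ u v => exact he
  · exact ha

/-- `N` may be only part of the neighbourhood of `v`, so the copy need not be induced; sparsity does
not need it to be. -/
lemma addVertex_isContained {φ : H ↪g G} {N : Finset W} {v : V} (hv : v ∉ Set.range φ)
    (hN : ∀ i ∈ N, G.Adj v (φ i)) : (addVertex H N).IsContained G := by
  refine ⟨⟨⟨fun x => x.elim v φ, ?_⟩, ?_⟩⟩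
  · rintro (_ | a) (_ | b) h
    · exact h.elim
    · exact hN b h
    · exact (hN a h).symm
    · exact φ.map_adj_iff.2 h
  · rintro (_ | a) (_ | b) h
    · rfl
    · exact absurd ⟨b, h.symm⟩ hv
    · exact absurd ⟨a, h⟩ hv
    · exact congrArg some (φ.injective h)

lemma Sparse.card_outer_neighbors_le [Finite W] (hG : Sparse G) {φ : H ↪g G} {N : Finset W} {v : V}
    (hv : v ∉ Set.range φ) (hN : ∀ i ∈ N, G.Adj v (φ i)) :
    2 * (H.edgeSet.ncard + N.card) + 2 ≤ 3 * (Nat.card W + 1) := by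
  have h1 := hG.two_mul_ncard_edgeSet_le (addVertex_isContained hv hN)
  have h2 := ncard_edgeSet_addVertex (H := H) N
  have h3 : Nat.card (Option W) = Nat.card W + 1 := Finite.card_option
  omega

/-- In a sparse graph, if three neighbours of an outer vertex would be too many, it has no
neighbours on the induced subgraph besides two given ones. -/
lemma Sparse.eq_or_eq_of_adj [Finite W] (hG : Sparse G) {φ : H ↪g G} {v : V}
    (hv : v ∉ Set.range φ) (hcard : 3 * (Nat.card W + 1) < 2 * (H.edgeSet.ncard + 3) + 2)
    {i j : W} (hij : i ≠ j) (hi : G.Adj v (φ i)) (hj : G.Adj v (φ j)) (l : W)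
    (hl : G.Adj v (φ l)) : l = i ∨ l = j := by
  classical
  by_contra! hne
  have := hG.card_outer_neighbors_le hv (N := {i, j, l}) (by simp [hi, hj, hl])
  rw [Finset.card_eq_three.2 ⟨i, j, l, hij, hne.1.symm, hne.2.symm, rfl⟩] at this
  omega

lemma Sparse.false_of_adj [Finite W] (hG : Sparse G) {φ : H ↪g G} {v : V}
    (hv : v ∉ Set.range φ) (hcard : 3 * (Nat.card W + 1) < 2 * (H.edgeSet.ncard + 2) + 2)
    {i j : W} (hij : i ≠ j) (hi : G.Adj v (φ i)) (hj : G.Adj v (φ j)) : False := by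
  classical
  have := hG.card_outer_neighbors_le hv (N := {i, j}) (by simp [hi, hj])
  rw [Finset.card_pair hij] at this
  omega

end Sparse

/-! ### Decidability and edge counts for the small graphs -/

section SmallGraphs

instance : DecidableRel triangle.Adj := inferInstanceAs (DecidableRel (completeGraph (Fin 3)).Adj)

instance : DecidableRel square.Adj := inferInstanceAs (DecidableRel (cycleGraph 4).Adj)

lemma diamond_adj {i j : Fin 4} : diamond.Adj i j ↔
    i ≠ j ∧ ¬ (i = 1 ∧ j = 3) ∧ ¬ (i = 3 ∧ j = 1) := by
  rw [diamond, sup_adj, edge_adj, cycleGraph_adj]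
  revert i j
  decide

instance : DecidableRel diamond.Adj := fun _ _ => decidable_of_iff _ diamond_adj.symm

instance (m n : ℕ) : DecidableRel (K m n).Adj := fun x y =>
  inferInstanceAs (Decidable (x.isLeft ∧ y.isRight ∨ x.isRight ∧ y.isLeft))

@[simp]
lemma K_adj_inl_inl {m n : ℕ} (a b : Fin m) : ¬ (K m n).Adj (.inl a) (.inl b) := by simp [K]

@[simp]
lemma K_adj_inr_inr {m n : ℕ} (a b : Fin n) : ¬ (K m n).Adj (.inr a) (.inr b) := by simp [K]

@[simp]
lemma K_adj_inl_inr {m n : ℕ} (a : Fin m) (b : Fin n) : (K m n).Adj (.inl a) (.inr b) := by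
  simp [K]

@[simp]
lemma K_adj_inr_inl {m n : ℕ} (a : Fin n) (b : Fin m) : (K m n).Adj (.inr a) (.inl b) := by
  simp [K]

lemma K33Minus_adj {x y : Fin 3 ⊕ Fin 3} : K33Minus.Adj x y ↔
    (K 3 3).Adj x y ∧ ¬ (x = .inl 0 ∧ y = .inr 0) ∧ ¬ (x = .inr 0 ∧ y = .inl 0) := by
  rw [K33Minus, deleteEdges_adj, Set.mem_singleton_iff, Sym2.eq_iff, not_or]

instance : DecidableRel K33Minus.Adj := fun _ _ => decidable_of_iff _ K33Minus_adj.symm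

lemma ncard_edgeSet_of_sum_degrees {W : Type*} [Fintype W] (H : SimpleGraph W)
    [DecidableRel H.Adj] {n : ℕ} (h : ∑ v, H.degree v = 2 * n) : H.edgeSet.ncard = n := by
  classical
  rw [sum_degrees_eq_twice_card_edges] at h
  rw [← coe_edgeFinset, Set.ncard_coe_finset]
  omega

lemma ncard_edgeSet_triangle : triangle.edgeSet.ncard = 3 :=
  ncard_edgeSet_of_sum_degrees _ (by decide)

lemma ncard_edgeSet_square : square.edgeSet.ncard = 4 :=
  ncard_edgeSet_of_sum_degrees _ (by decide)

lemma ncard_edgeSet_diamond : diamond.edgeSet.ncard = 5 :=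
  ncard_edgeSet_of_sum_degrees _ (by decide)

lemma ncard_edgeSet_K_two_three : (K 2 3).edgeSet.ncard = 6 :=
  ncard_edgeSet_of_sum_degrees _ (by decide)

lemma ncard_edgeSet_K33Minus : K33Minus.edgeSet.ncard = 8 :=
  ncard_edgeSet_of_sum_degrees _ (by decide)

end SmallGraphs

section ShortPaths

variable {W : Type*} [Fintype W] [DecidableEq W] (H : SimpleGraph W) [DecidableRel H.Adj]

instance : Decidable (HasShortPaths H) := by unfold HasShortPaths; infer_instance

instance : Decidable (HasShortCycles H) := by unfold HasShortCycles; infer_instance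

set_option maxRecDepth 10000 in
lemma hasShortPaths_K33Minus : HasShortPaths K33Minus := by decide

set_option maxRecDepth 10000 in
lemma hasShortCycles_K33Minus : HasShortCycles K33Minus := by decide

end ShortPaths

/-! ### The forced one-vertex extensions -/

section Contained

variable {V W : Type*} {G : SimpleGraph V} {H : SimpleGraph W}

lemma isIndContained_of_sum {A B : Type*} {H : SimpleGraph (A ⊕ B)} (f : A → V) (g : B → V)
    (hf : ∀ a a', a ≠ a' → f a ≠ f a' ∧ ¬ G.Adj (f a) (f a'))
    (hg : ∀ b b', b ≠ b' → g b ≠ g b' ∧ ¬ G.Adj (g b) (g b'))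
    (hfg : ∀ a b, f a ≠ g b ∧ (G.Adj (f a) (g b) ↔ H.Adj (.inl a) (.inr b)))
    (hl : ∀ a a', ¬ H.Adj (.inl a) (.inl a')) (hr : ∀ b b', ¬ H.Adj (.inr b) (.inr b')) :
    H.IsIndContained G := by
  refine ⟨⟨⟨Sum.elim f g, ?_⟩, ?_⟩⟩
  · rintro (a | b) (a' | b') h
    · by_contra hne
      exact (hf a a' (fun h => hne (h ▸ rfl))).1 h
    · exact absurd h (hfg a b').1
    · exact absurd h.symm (hfg a' b).1
    · by_contra hne
      exact (hg b b' (fun h => hne (h ▸ rfl))).1 h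
  · rintro (a | b) (a' | b')
    · refine iff_of_false (fun h => (hf a a' ?_).2 h) (hl a a')
      rintro rfl
      exact G.loopless.irrefl _ h
    · exact (hfg a b').2
    · exact (G.adj_comm _ _).trans ((hfg a' b).2.trans (H.adj_comm _ _))
    · refine iff_of_false (fun h => (hg b b' ?_).2 h) (hr b b')
      rintro rfl
      exact G.loopless.irrefl _ h

/-- An outer vertex with exactly two, adjacent, neighbours on an edge of a chordless `4`-cycle
yields a house. -/
lemma house_isIndContained_of_outer {φ : H ↪g G} {v : V} {s t c d : W} (hvs : G.Adj v (φ s))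
    (hvt : G.Adj v (φ t)) (hN : ∀ l, G.Adj v (φ l) → l = s ∨ l = t) (hst : H.Adj s t)
    (htc : H.Adj t c) (hcd : H.Adj c d) (hds : H.Adj d s) (htd : ¬ H.Adj t d) (hsc : ¬ H.Adj s c)
    (hcs : c ≠ s) (hdt : d ≠ t) : house.IsIndContained G := by
  refine house_isIndContained (a := φ s) (b := φ t) (c := φ c) (d := φ d) (e := v)
    (φ.map_adj_iff.2 hst) (φ.map_adj_iff.2 htc) (φ.map_adj_iff.2 hcd) (φ.map_adj_iff.2 hds.symm)
    hvs.symm hvt.symm (fun h => hsc (φ.map_adj_iff.1 h)) (fun h => htd (φ.map_adj_iff.1 h)) ?_ ?_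
  · intro h
    rcases hN c h.symm with h | h
    exacts [hcs h, htc.ne' h]
  · intro h
    rcases hN d h.symm with h | h
    exacts [hds.ne h, hdt h]

/-- In a house-free graph, if an outer vertex has exactly two neighbours on a triangle-free induced
subgraph with short cycles, then they are not adjacent. -/
lemma not_adj_of_outer {φ : H ↪g G} {v : V} {i j : W} (hhouse : IndFree house G)
    (hi : G.Adj v (φ i)) (hj : G.Adj v (φ j)) (hN : ∀ l, G.Adj v (φ l) → l = i ∨ l = j)
    (htri : ∀ s t c, H.Adj s t → H.Adj s c → ¬ H.Adj t c) (hC : HasShortCycles H) :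
    ¬ H.Adj i j := by
  intro hij
  rcases hC i j hij with ⟨c, h1, h2⟩ | ⟨c, d, htc, hcd, hds, htd, hsc, hcs, hdt⟩
  · exact htri i j c hij h1 h2
  · exact hhouse (house_isIndContained_of_outer hi hj hN hij htc hcd hds htd hsc hcs hdt)

lemma diamond_isIndContained_of_triangle (hG : Sparse G) {φ : triangle ↪g G} {v : V}
    (hv : v ∉ Set.range φ) {i j : Fin 3} (hij : i ≠ j) (hi : G.Adj v (φ i))
    (hj : G.Adj v (φ j)) : diamond.IsIndContained G := by
  -- A third neighbour would give 6 edges on 4 vertices, where 5 are allowed.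
  have hN := hG.eq_or_eq_of_adj hv (by simp [ncard_edgeSet_triangle]) hij hi hj
  obtain ⟨l, hli, hlj⟩ : ∃ l, l ≠ i ∧ l ≠ j := by clear hN hi hj; revert i j; decide
  have hl : ¬ G.Adj v (φ l) := fun h => (hN l h).elim hli hlj
  have hadj : ∀ {a b}, a ≠ b → G.Adj (φ a) (φ b) := fun h => φ.map_adj_iff.2 h
  have hne : φ l ≠ v := fun h => hv ⟨l, h⟩
  -- The only nonadjacent pair, `φ l` and `v`, goes to the positions `1` and `3` missing in
  -- `diamond`.
  refine isIndContained_of_lt ![φ i, φ l, φ j, v] fun a b hab => ?_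
  fin_cases a <;> fin_cases b <;> first | exact absurd hab (by decide) | skip
  all_goals simp [diamond_adj, φ.injective.eq_iff, hadj, hij, hlj, hli.symm, hi.symm, hj.symm,
    hi.ne', hj.ne', hne, G.adj_comm _ v, hl]

lemma K_two_three_isIndContained_of_square (hG : Sparse G) (hhouse : IndFree house G)
    {φ : square ↪g G} {v : V} (hv : v ∉ Set.range φ) {i j : Fin 4} (hij : i ≠ j)
    (hi : G.Adj v (φ i)) (hj : G.Adj v (φ j)) : (K 2 3).IsIndContained G := by
  have hN := hG.eq_or_eq_of_adj hv (by simp [ncard_edgeSet_square]) hij hi hj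
  have hnadj := not_adj_of_outer hhouse hi hj hN (by decide) (by decide)
  obtain ⟨c, d, hci, hcj, hdi, hdj, hcd, hcd'⟩ : ∃ c d, square.Adj i c ∧ square.Adj j c ∧
      square.Adj i d ∧ square.Adj j d ∧ c ≠ d ∧ ¬ square.Adj c d := by
    clear hN hi hj
    revert i j; decide
  have hc : ¬ G.Adj v (φ c) := fun h => (hN c h).elim hci.ne' hcj.ne'
  have hd : ¬ G.Adj v (φ d) := fun h => (hN d h).elim hdi.ne' hdj.ne'
  have hne : ∀ l, φ l ≠ v := fun l h => hv ⟨l, h⟩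
  refine isIndContained_of_sum ![φ i, φ j] ![φ c, φ d, v] ?_ ?_ ?_ (by decide) (by decide)
  · intro a b hab
    fin_cases a <;> fin_cases b <;> first | exact absurd rfl hab | skip
    all_goals simp [φ.injective.eq_iff, φ.map_adj_iff, hij, hij.symm, hnadj, square.adj_comm j i]
  · intro a b hab
    fin_cases a <;> fin_cases b <;> first | exact absurd rfl hab | skip
    all_goals simp [φ.injective.eq_iff, φ.map_adj_iff, hcd, hcd.symm, hcd', square.adj_comm d c,
      hc, hd, hne, (hne _).symm, G.adj_comm _ v]
  · intro a b
    fin_cases a <;> fin_cases b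
    all_goals simp [φ.injective.eq_iff, φ.map_adj_iff, hci, hcj, hdi, hdj, hci.ne, hcj.ne,
      hdi.ne, hdj.ne, hne, hi.symm, hj.symm]

lemma K33Minus_isIndContained_of_K_two_three (hG : Sparse G) (hK : IndFree (K 2 4) G)
    (hhouse : IndFree house G) {φ : K 2 3 ↪g G} {v : V} (hv : v ∉ Set.range φ)
    {i j : Fin 2 ⊕ Fin 3} (hij : i ≠ j) (hi : G.Adj v (φ i)) (hj : G.Adj v (φ j)) :
    K33Minus.IsIndContained G := by
  -- A third neighbour would give 9 edges on 6 vertices, where 8 are allowed.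
  have hN := hG.eq_or_eq_of_adj hv (by simp [ncard_edgeSet_K_two_three]) hij hi hj
  have hnadj := not_adj_of_outer hhouse hi hj hN (by decide) (by decide)
  have hne : ∀ l, φ l ≠ v := fun l h => hv ⟨l, h⟩
  have hll : ∀ a b, ¬ G.Adj (φ (.inl a)) (φ (.inl b)) := fun a b => by simp [φ.map_adj_iff]
  have hrr : ∀ a b, ¬ G.Adj (φ (.inr a)) (φ (.inr b)) := fun a b => by simp [φ.map_adj_iff]
  have hlr : ∀ a b, G.Adj (φ (.inl a)) (φ (.inr b)) := fun a b => by simp [φ.map_adj_iff]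
  rcases i with i | i <;> rcases j with j | j
  -- Both neighbours on the side of size two: `v` becomes a fourth vertex of the other side.
  · refine (hK ?_).elim
    have hvl : ∀ l, G.Adj v (φ (.inl l)) := by
      intro l
      have : l = i ∨ l = j := by clear hN hi hj hnadj; revert i j l; decide
      rcases this with rfl | rfl
      exacts [hi, hj]
    have hvr : ∀ l, ¬ G.Adj v (φ (.inr l)) := fun l h => by simpa using hN _ h
    refine isIndContained_of_sum (fun l => φ (.inl l)) (Fin.cons v fun l => φ (.inr l))
      ?_ ?_ ?_ (by decide) (by decide)
    · exact fun a b hab => ⟨fun h => hab (Sum.inl_injective (φ.injective h)), hll a b⟩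
    · intro a b hab
      cases a using Fin.cases <;> cases b using Fin.cases
      · exact absurd rfl hab
      · simp [hvr, (hne _).symm]
      · simp [hvr, hne, G.adj_comm _ v]
      · rename_i a b
        have : a ≠ b := fun h => hab (h ▸ rfl)
        simp [hrr, φ.injective.eq_iff, this]
    · intro a b
      cases b using Fin.cases
      · simp [hne, G.adj_comm _ v, hvl]
      · simp [hlr, φ.injective.eq_iff]
  · exact (hnadj (by simp)).elim
  · exact (hnadj (by simp)).elim
  · obtain ⟨l, hli, hlj⟩ : ∃ l, l ≠ i ∧ l ≠ j := by clear hN hi hj hnadj; revert i j; decide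
    have hij' : i ≠ j := fun h => hij (h ▸ rfl)
    have hvl : ¬ G.Adj v (φ (.inr l)) := fun h => by
      simpa [hli, hlj] using hN _ h
    have hvll : ∀ l, ¬ G.Adj v (φ (.inl l)) := fun l h => by simpa using hN _ h
    -- The vertex `v` joins the side of size two, and its non-neighbour `φ (.inr l)` takes the other
    -- end of the deleted edge.
    refine isIndContained_of_sum ![φ (.inr l), φ (.inr i), φ (.inr j)]
      ![v, φ (.inl 0), φ (.inl 1)] ?_ ?_ ?_ (by decide) (by decide)
    · intro a b hab
      fin_cases a <;> fin_cases b <;> first | exact absurd rfl hab | skip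
      all_goals simp [φ.injective.eq_iff, hrr, hli, hlj, hij', hli.symm, hlj.symm, hij'.symm]
    · intro a b hab
      fin_cases a <;> fin_cases b <;> first | exact absurd rfl hab | skip
      all_goals simp [φ.injective.eq_iff, hll, hvll, hne, (hne _).symm, G.adj_comm _ v]
    · intro a b
      fin_cases a <;> fin_cases b
      all_goals simp [K33Minus_adj, φ.injective.eq_iff, hne, G.adj_comm _ v, hvl, hi, hj,
        (hlr _ _).symm]

end Contained

/-! ### Growing the graph: (b) implies (c) -/

section Classification

variable {V : Type*} {G : SimpleGraph V}

/-- A `2`-connected distance-hereditary graph contains an induced triangle or square. -/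
lemma triangle_or_square_isIndContained (h2 : TwoConnected G) (hdh : DistanceHereditary G) :
    triangle.IsIndContained G ∨ square.IsIndContained G := by
  have hfin : Finite V := Nat.finite_of_card_ne_zero (by have := h2.1; omega)
  have : Nontrivial V := Finite.one_lt_card_iff_nontrivial.1 (by have := h2.1; omega)
  obtain ⟨u⟩ := h2.2.1.nonempty
  obtain ⟨w, huw⟩ := h2.2.1.preconnected.exists_adj_of_nontrivial u
  have hne : ({u, w} : Set V) ≠ Set.univ := by
    intro h
    have h3 := h2.1
    rw [← Set.ncard_univ, ← h, Set.ncard_pair huw.ne] at h3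
    omega
  -- An ear on a single edge has adjacent ends, so it closes to a cycle.
  obtain ⟨k, p, hear⟩ := exists_isShortestEar h2.2.1 h2.2.2 (Set.nontrivial_pair huw.ne) hne
  have hst : G.Adj (p 0) (p (k + 1)) := by
    have h0 := hear.start_mem
    have h1 := hear.end_mem
    have h01 := hear.ends_ne
    simp only [Set.mem_insert_iff, Set.mem_singleton_iff] at h0 h1
    rcases h0 with h0 | h0 <;> rcases h1 with h1 | h1 <;> rw [h0, h1] at h01 ⊢
    exacts [(h01 rfl).elim, huw, huw.symm, (h01 rfl).elim]
  rcases hear.pos.lt_or_eq with hk | rfl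
  · right
    obtain rfl := exists_cycle_of_isShortestEar hdh.2.1 hear hk hst
    refine cycleGraph_isIndContained (f := p) fun i j hij hj => ⟨hear.ne hk hij (by omega), ?_⟩
    by_cases h : i = 0 ∧ j = 2 + 1
    · obtain ⟨rfl, rfl⟩ := h
      simpa using hst
    · rw [hear.adj_iff hk hij (by omega) h]
      omega
  · left
    have h01 := hear.adj 0 (by omega)
    have h12 := hear.adj 1 (by omega)
    simp only [zero_add, Nat.reduceAdd] at hst h01 h12
    refine isIndContained_of_lt ![p 0, p 1, p 2] fun i j hij => ?_
    fin_cases i <;> fin_cases j <;> first | exact absurd hij (by decide) | skip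
    all_goals simp [triangle, h01, h12, hst, h01.ne, h12.ne, hst.ne]

lemma nonempty_iso_of_surjective {W : Type*} {H : SimpleGraph W} (φ : H ↪g G)
    (hφ : Function.Surjective φ) : Nonempty (G ≃g H) :=
  ⟨(RelIso.ofSurjective φ hφ).symm⟩

lemma classification (h2 : TwoConnected G) (hdh : DistanceHereditary G) (hG : Sparse G)
    (hK : IndFree (K 2 4) G) :
    Nonempty (G ≃g triangle) ∨ Nonempty (G ≃g square) ∨ Nonempty (G ≃g diamond) ∨
      Nonempty (G ≃g K 2 3) ∨ Nonempty (G ≃g K33Minus) := by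
  rcases triangle_or_square_isIndContained h2 hdh with h | h
  · obtain ⟨φ⟩ := h
    by_cases hφ : Function.Surjective φ
    · exact .inl (nonempty_iso_of_surjective φ hφ)
    obtain ⟨v, hv, i, j, hij, hi, hj⟩ :=
      exists_outer_common_neighbor h2 hdh φ (by decide) (by decide) hφ
    obtain ⟨ψ⟩ := diamond_isIndContained_of_triangle hG hv hij hi hj
    by_cases hψ : Function.Surjective ψ
    · exact .inr (.inr (.inl (nonempty_iso_of_surjective ψ hψ)))
    obtain ⟨v, hv, i, j, hij, hi, hj⟩ :=
      exists_outer_common_neighbor h2 hdh ψ (by decide) (by decide) hψ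
    -- This would be 7 edges on 5 vertices, where 6 are allowed.
    exact (hG.false_of_adj hv (by simp [ncard_edgeSet_diamond]) hij hi hj).elim
  · obtain ⟨φ⟩ := h
    by_cases hφ : Function.Surjective φ
    · exact .inr (.inl (nonempty_iso_of_surjective φ hφ))
    obtain ⟨v, hv, i, j, hij, hi, hj⟩ :=
      exists_outer_common_neighbor h2 hdh φ (by decide) (by decide) hφ
    obtain ⟨ψ⟩ := K_two_three_isIndContained_of_square hG hdh.1 hv hij hi hj
    by_cases hψ : Function.Surjective ψ
    · exact .inr (.inr (.inr (.inl (nonempty_iso_of_surjective ψ hψ))))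
    have : Nontrivial (Fin 2 ⊕ Fin 3) := ⟨.inl 0, .inr 0, by simp⟩
    obtain ⟨v, hv, i, j, hij, hi, hj⟩ :=
      exists_outer_common_neighbor h2 hdh ψ (by decide) (by decide) hψ
    obtain ⟨χ⟩ := K33Minus_isIndContained_of_K_two_three hG hK hdh.1 hv hij hi hj
    by_cases hχ : Function.Surjective χ
    · exact .inr (.inr (.inr (.inr (nonempty_iso_of_surjective χ hχ))))
    have : Nontrivial (Fin 3 ⊕ Fin 3) := ⟨.inl 0, .inr 0, by simp⟩
    obtain ⟨v, hv, i, j, hij, hi, hj⟩ := exists_outer_common_neighbor h2 hdh χ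
      hasShortPaths_K33Minus hasShortCycles_K33Minus hχ
    -- This would be 10 edges on 7 vertices, where 9 are allowed.
    exact (hG.false_of_adj hv (by simp [ncard_edgeSet_K33Minus]) hij hi hj).elim

end Classification

/-! ### Explicit decompositions: (c) implies (a) -/

section Decompositions

/-- A graph whose edges join mates with respect to `m`, or vertices to their parent with respect
to `p`, is the union of a matching and a tree. -/
lemma splits_of_mate_of_parent {W : Type*} [Fintype W] [DecidableEq W] (H : SimpleGraph W)
    (m p : W → W) (r : W) (hm : ∀ x, m (m x) = x)
    (hH : ∀ x y, H.Adj x y ↔ x ≠ y ∧ (m x = y ∨ p x = y ∨ p y = x)) (n : ℕ)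
    (hr : ∀ x, p^[n] x = r) (hpr : p r = r) : Splits H := by
  let M : SimpleGraph W := fromRel fun x y => m x = y
  let F : SimpleGraph W := fromRel fun x y => p x = y
  have hreach : ∀ k x, F.Reachable x (p^[k] x) := by
    intro k
    induction k with
    | zero => exact fun x => .rfl
    | succ k ih =>
      intro x
      refine .trans ?_ (ih (p x))
      by_cases h : x = p x
      · rw [← h]
      · exact Adj.reachable ((fromRel_adj ..).2 ⟨h, .inl rfl⟩)
  have hconn : F.Connected :=
    (connected_iff_exists_forall_reachable _).2 ⟨r, fun x => (hr x ▸ hreach n x).symm⟩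
  -- Each edge joins a non-root vertex to its parent, which bounds the edges by `|W| - 1`;
  -- connectedness gives the reverse bound, so `F` is a tree.
  have hsub : F.edgeSet ⊆ (fun x => s(x, p x)) '' {r}ᶜ := by
    intro e he
    induction e with
    | _ x y =>
      obtain ⟨hxy, h | h⟩ := (fromRel_adj (fun x y => p x = y) x y).1 he
      · exact ⟨x, fun hx => hxy (by rw [← h, hx, hpr]), by simp [h]⟩
      · exact ⟨y, fun hy => hxy (by rw [← h, hy, hpr]), by simp [h, Sym2.eq_swap]⟩
  have hle : F.edgeSet.ncard + 1 ≤ Nat.card W := by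
    have h1 := (Set.ncard_le_ncard hsub).trans (Set.ncard_image_le)
    have h2 := Set.ncard_add_ncard_compl ({r} : Set W)
    rw [Set.ncard_singleton] at h2
    omega
  have hge := hconn.card_vert_le_card_edgeSet_add_one
  rw [Nat.card_coe_set_eq] at hge
  refine ⟨M, F, ?_, ?_, (isTree_iff_connected_and_card.2 ⟨hconn, ?_⟩).isAcyclic⟩
  · ext x y
    rw [sup_adj, hH, fromRel_adj, fromRel_adj]
    have : m y = x ↔ m x = y :=
      ⟨fun h => by rw [← h, hm], fun h => by rw [← h, hm]⟩
    tauto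
  · have hM : ∀ x y, M.Adj x y → m x = y := by
      intro x y h
      rcases ((fromRel_adj ..).1 h).2 with h | h
      · exact h
      · rw [← h, hm]
    exact fun x y z hy hz => (hM x y hy).symm.trans (hM x z hz)
  · rw [Nat.card_coe_set_eq]
    omega

/-- In these decompositions, fixed points of the mate map are the unmatched vertices, and the
numeral after the first two `decide`s is the height of the tree. -/
lemma splits_triangle : Splits triangle :=
  splits_of_mate_of_parent _ ![1, 0, 2] ![2, 2, 2] 2 (by decide) (by decide) 1 (by decide)
    (by decide)

lemma splits_square : Splits square :=
  splits_of_mate_of_parent _ ![1, 0, 2, 3] ![3, 2, 3, 3] 3 (by decide) (by decide) 2 (by decide)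
    (by decide)

lemma splits_diamond : Splits diamond :=
  splits_of_mate_of_parent _ ![1, 0, 3, 2] ![2, 2, 2, 0] 2 (by decide) (by decide) 2 (by decide)
    (by decide)

lemma splits_K_two_three : Splits (K 2 3) :=
  splits_of_mate_of_parent _ (Sum.elim ![.inr 0, .inr 1] ![.inl 0, .inl 1, .inr 2])
    (Sum.elim ![.inr 2, .inr 2] ![.inl 1, .inl 0, .inr 2]) (.inr 2) (by decide) (by decide) 2
    (by decide) (by decide)

/-- The tree is a Hamiltonian path and the remaining edges form a perfect matching. -/
lemma splits_K33Minus : Splits K33Minus :=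
  splits_of_mate_of_parent _
    (Sum.elim ![.inr 1, .inr 0, .inr 2] ![.inl 1, .inl 0, .inl 2])
    (Sum.elim ![.inr 2, .inr 2, .inr 1] ![.inl 2, .inl 1, .inr 2]) (.inr 2) (by decide)
    (by decide) 4 (by decide) (by decide)

lemma Splits.of_iso {V W : Type*} {G : SimpleGraph V} {H : SimpleGraph W} (h : Splits H)
    (e : Nonempty (G ≃g H)) : Splits G :=
  h.of_isContained ⟨e.some.toCopy⟩

end Decompositions

end MDecyc

theorem theorem7 {V : Type*} [Finite V] (G : SimpleGraph V)
    (h2 : MDecyc.TwoConnected G) (hdh : MDecyc.DistanceHereditary G) :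
    List.TFAE [
      MDecyc.MDecyclable G,
      MDecyc.Sparse G ∧ MDecyc.IndFree (MDecyc.K 2 4) G,
      Nonempty (G ≃g MDecyc.triangle) ∨ Nonempty (G ≃g MDecyc.square) ∨
        Nonempty (G ≃g MDecyc.diamond) ∨ Nonempty (G ≃g MDecyc.K 2 3) ∨
        Nonempty (G ≃g MDecyc.K33Minus)] := by
  tfae_have 1 → 2 := by
    intro h
    rw [MDecyc.mDecyclable_iff_splits] at h
    exact ⟨h.sparse, fun hK => MDecyc.not_splits_K_two_four (h.of_isContained hK.isContained)⟩
  tfae_have 2 → 3 := fun h => MDecyc.classification h2 hdh h.1 h.2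
  tfae_have 3 → 1 := by
    rw [MDecyc.mDecyclable_iff_splits]
    rintro (e | e | e | e | e)
    exacts [MDecyc.splits_triangle.of_iso e, MDecyc.splits_square.of_iso e,
      MDecyc.splits_diamond.of_iso e, MDecyc.splits_K_two_three.of_iso e,
      MDecyc.splits_K33Minus.of_iso e]
  tfae_finish
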